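/- All graphs are simple and undirected, with a nonempty vertex set, finite or infinite, and not necessarily connected. A graph $G$ is regarded as a metric space whose points are its vertices and the points of its edges, every edge being isometric to $[0,1]$; the distance between two points is the infimum of the lengths of the paths joining them, and it is $\infty$ if they lie in different connected components. A geodesic triangle $T$ in $G$ consists of three points and three geodesics joining them in pairs. It is $\delta$-thin if every point of each side is at distance at most $\delta$ from the union of the other two sides, and $\delta(T)$ is the infimum of the $\delta\ge 0$ for which $T$ is $\delta$-thin. The hyperbolicity constant is $\delta(G):=\sup_T\delta(T)\in[0,\infty]$, the supremum being over all geodesic triangles $T$ in $G$, and $G$ is hyperbolic if there is a real $\delta\ge 0$ such that every geodesic triangle in $G$ is $\delta$-thin (equivalently, $\delta(G)<\infty$). The corona $G_1\diamond G_2$ of two graphs is obtained by taking one copy of $G_1$ and, for each vertex $v$ of $G_1$, one copy of $G_2$, and then joining each vertex $v$ of $G_1$ to every vertex of the $v$-th copy of $G_2$. **Corollary.** Let $G_1,G_2$ be any two graphs. Then $G_1\diamond G_2$ is hyperbolic if and only if $G_1$ is hyperbolic. Moreover, $$\delta(G_1)\le\delta(G_1\diamond G_2)\le\max\{\delta(G_1),\,3/2\}.$$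 -/

import Mathlib

open scoped ENNReal NNReal

/-! ### Geodesic triangles and hyperbolicity in a metric space with possibly infinite distances -/

section Hyperbolicity

/-- `S` is (the image of) a geodesic from `x` to `y`: it is parametrized by arc length by an
isometric map from a compact interval `[0, L]`. -/
def IsGeodesicSegment {X : Type*} [EMetricSpace X] (x y : X) (S : Set X) : Prop :=
  ∃ (L : ℝ) (γ : ℝ → X), 0 ≤ L ∧ γ 0 = x ∧ γ L = y ∧
    (∀ s ∈ Set.Icc (0 : ℝ) L, ∀ t ∈ Set.Icc (0 : ℝ) L,
      edist (γ s) (γ t) = ENNReal.ofReal |s - t|) ∧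
    S = γ '' Set.Icc (0 : ℝ) L

/-- A geodesic triangle: three points and a choice of three geodesics joining them. -/
structure GeodesicTriangle (X : Type*) [EMetricSpace X] where
  /-- first corner -/
  p₁ : X
  /-- second corner -/
  p₂ : X
  /-- third corner -/
  p₃ : X
  /-- the geodesic from the first to the second corner -/
  side₁₂ : Set X
  /-- the geodesic from the second to the third corner -/
  side₂₃ : Set X
  /-- the geodesic from the third to the first corner -/
  side₃₁ : Set X
  isGeodesic₁₂ : IsGeodesicSegment p₁ p₂ side₁₂
  isGeodesic₂₃ : IsGeodesicSegment p₂ p₃ side₂₃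
  isGeodesic₃₁ : IsGeodesicSegment p₃ p₁ side₃₁

/-- Every point of every side is at distance at most `δ` from the union of the other two sides. -/
def GeodesicTriangle.IsThin {X : Type*} [EMetricSpace X] (T : GeodesicTriangle X) (δ : ℝ≥0) :
    Prop :=
  (∀ p ∈ T.side₁₂, Metric.infEDist p (T.side₂₃ ∪ T.side₃₁) ≤ δ) ∧
  (∀ p ∈ T.side₂₃, Metric.infEDist p (T.side₃₁ ∪ T.side₁₂) ≤ δ) ∧
  (∀ p ∈ T.side₃₁, Metric.infEDist p (T.side₁₂ ∪ T.side₂₃) ≤ δ)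

/-- The sharp thin constant `δ(T)`. -/
noncomputable def GeodesicTriangle.thinConst {X : Type*} [EMetricSpace X]
    (T : GeodesicTriangle X) : ℝ≥0∞ :=
  ⨅ (δ : ℝ≥0) (_ : T.IsThin δ), (δ : ℝ≥0∞)

/-- The space is `δ`-hyperbolic: all its geodesic triangles are `δ`-thin. -/
def IsDeltaHyperbolic (X : Type*) [EMetricSpace X] (δ : ℝ≥0) : Prop :=
  ∀ T : GeodesicTriangle X, T.IsThin δ

/-- The space is hyperbolic: it is `δ`-hyperbolic for some finite `δ ≥ 0`. -/
def IsHyperbolic (X : Type*) [EMetricSpace X] : Prop :=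
  ∃ δ : ℝ≥0, IsDeltaHyperbolic X δ

/-- The sharp hyperbolicity constant `δ(X)`, the supremum of `δ(T)` over all geodesic triangles.
(A geodesic triangle has finite side lengths, so it lies in a single component; hence this is also
the supremum of the hyperbolicity constants of the components.) -/
noncomputable def hyperbolicityConst (X : Type*) [EMetricSpace X] : ℝ≥0∞ :=
  ⨆ T : GeodesicTriangle X, T.thinConst

end Hyperbolicity

/-! ### A graph as a metric space -/

namespace SimpleGraph

/-- The points of a graph in which every edge is a copy of the interval `[0, 1]`, in barycentric
coordinates: a point is either a vertex `v` (coordinate `1` at `v`, `0` elsewhere), or lies on an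
edge `[u, v]`; in the latter case its two coordinates at `u` and `v` sum to `1`, its distance along
the edge from `u` is `1 - coord u = coord v`, and all other coordinates are `0`. -/
@[ext]
structure Realization {V : Type*} (G : SimpleGraph V) where
  /-- the barycentric coordinates -/
  coord : V → ℝ
  coord_nonneg : ∀ v, 0 ≤ coord v
  vertex_or_edge :
    (∃ v, coord v = 1 ∧ ∀ w, w ≠ v → coord w = 0) ∨
    (∃ u v, G.Adj u v ∧ coord u + coord v = 1 ∧ ∀ w, w ≠ u → w ≠ v → coord w = 0)

namespace Realization

variable {V : Type*} {G : SimpleGraph V}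

/-- `[u, v]` is an edge of the graph and the point `x` lies on it (possibly at an end). -/
def OnEdge (x : G.Realization) (u v : V) : Prop :=
  G.Adj u v ∧ ∀ w, w ≠ u → w ≠ v → x.coord w = 0

/-- The distance from the point `x` to the vertex `v`: the infimum of the lengths of the paths that
first run from `x` to an end `u` of its edge and then along a walk from `u` to `v` (if `x` is a
vertex then `u = x`). -/
noncomputable def distToVertex (x : G.Realization) (v : V) : ℝ≥0∞ :=
  ⨅ (u : V) (_ : x.coord u ≠ 0), (ENNReal.ofReal (1 - x.coord u) + (G.edist u v : ℝ≥0∞))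

/-- The length of the segment between `x` and `y` inside a common edge; `∞` if there is none. -/
noncomputable def distInEdge (x y : G.Realization) : ℝ≥0∞ :=
  ⨅ (u : V) (v : V) (_ : x.OnEdge u v) (_ : y.OnEdge u v), ENNReal.ofReal |x.coord u - y.coord u|

/-- The shortest-path distance: a path from `x` to `y` either is a segment of a common edge or
passes through some vertex. It is `∞` if and only if `x` and `y` lie in different components. -/
noncomputable instance : EDist G.Realization where
  edist x y := min (distInEdge x y) (⨅ v : V, (x.distToVertex v + y.distToVertex v))

theorem edist_def (x y : G.Realization) :
    EDist.edist x y = min (distInEdge x y) (⨅ v : V, (x.distToVertex v + y.distToVertex v)) := rfl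

theorem OnEdge.symm {x : G.Realization} {u v : V} (h : x.OnEdge u v) : x.OnEdge v u :=
  ⟨h.1.symm, fun w h1 h2 => h.2 w h2 h1⟩

theorem OnEdge.add_eq_one {x : G.Realization} {u v : V} (h : x.OnEdge u v) :
    x.coord u + x.coord v = 1 := by
  have hne := h.1.ne
  rcases x.vertex_or_edge with ⟨a, h1, h2⟩ | ⟨a, b, hab, h1, h2⟩
  · by_cases hau : a = u
    · subst hau; rw [h1, h2 v hne.symm]; simp
    · by_cases hav : a = v
      · subst hav; rw [h1, h2 u hne]; simp
      · have := h.2 a hau hav; linarith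
  · have hne' := hab.ne
    by_cases hau : a = u
    · subst hau
      by_cases hbv : b = v
      · subst hbv; exact h1
      · have e1 := h.2 b hne'.symm hbv
        have e2 := h2 v hne.symm (Ne.symm hbv)
        linarith
    · by_cases hav : a = v
      · subst hav
        by_cases hbu : b = u
        · subst hbu; linarith
        · have e1 := h.2 b hbu hne'.symm
          have e2 := h2 u hne (Ne.symm hbu)
          linarith
      · have e0 := h.2 a hau hav
        by_cases hbu : b = u
        · subst hbu
          have e2 := h2 v (Ne.symm hav) hne.symm
          linarith
        · by_cases hbv : b = v
          · subst hbv
            have e2 := h2 u (Ne.symm hau) hne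
            linarith
          · have := h.2 b hbu hbv; linarith

theorem coord_add_le_one (x : G.Realization) {u v : V} (huv : u ≠ v) :
    x.coord u + x.coord v ≤ 1 := by
  rcases x.vertex_or_edge with ⟨a, h1, h2⟩ | ⟨a, b, hab, h1, h2⟩
  · by_cases hau : u = a
    · subst hau; rw [h1, h2 v huv.symm]; simp
    · rw [h2 u hau]
      by_cases hav : v = a
      · subst hav; rw [h1]; simp
      · rw [h2 v hav]; simp
  · have na := x.coord_nonneg a
    have nb := x.coord_nonneg b
    by_cases hua : u = a
    · subst hua
      by_cases hvb : v = b
      · subst hvb; exact h1.le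
      · have := h2 v huv.symm hvb; linarith
    · by_cases hub : u = b
      · subst hub
        by_cases hva : v = a
        · subst hva; linarith
        · have := h2 v hva huv.symm; linarith
      · rw [h2 u hua hub]
        by_cases hva : v = a
        · subst hva; linarith
        · by_cases hvb : v = b
          · subst hvb; linarith
          · rw [h2 v hva hvb]; simp

theorem coord_le_one (x : G.Realization) (v : V) : x.coord v ≤ 1 := by
  rcases x.vertex_or_edge with ⟨a, h1, h2⟩ | ⟨a, b, hab, h1, h2⟩
  · by_cases h : v = a
    · rw [h, h1]
    · rw [h2 v h]; simp
  · have na := x.coord_nonneg a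
    have nb := x.coord_nonneg b
    by_cases hva : v = a
    · subst hva; linarith
    · by_cases hvb : v = b
      · subst hvb; linarith
      · rw [h2 v hva hvb]; simp

theorem one_le_edist_coe {u v : V} (h : u ≠ v) : (1 : ℝ≥0∞) ≤ (G.edist u v : ℝ≥0∞) := by
  have h1 : (1 : ℕ∞) ≤ G.edist u v :=
    Order.one_le_iff_pos.mpr (pos_iff_ne_zero.mpr (fun h0 => h (SimpleGraph.edist_eq_zero_iff.mp h0)))
  exact_mod_cast h1

theorem edist_triangle_coe (u v w : V) :
    (G.edist u w : ℝ≥0∞) ≤ (G.edist u v : ℝ≥0∞) + (G.edist v w : ℝ≥0∞) := by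
  have := SimpleGraph.edist_triangle (G := G) (u := u) (v := v) (w := w)
  exact_mod_cast this

theorem le_distToVertex (x : G.Realization) (v : V) :
    ENNReal.ofReal (1 - x.coord v) ≤ x.distToVertex v := by
  refine le_iInf₂ fun u _ => ?_
  by_cases h : u = v
  · subst h; exact le_self_add
  · calc ENNReal.ofReal (1 - x.coord v) ≤ 1 := by
          rw [← ENNReal.ofReal_one]
          exact ENNReal.ofReal_le_ofReal (by linarith [x.coord_nonneg v])
      _ ≤ _ := (one_le_edist_coe h).trans le_add_self

theorem distToVertex_le_add (x : G.Realization) (v w : V) :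
    x.distToVertex w ≤ x.distToVertex v + (G.edist v w : ℝ≥0∞) := by
  simp only [distToVertex, ENNReal.iInf_add]
  refine iInf₂_mono fun u _ => ?_
  rw [add_assoc]
  gcongr
  exact edist_triangle_coe _ _ _

theorem edist_le_distToVertex_add (x : G.Realization) (v w : V) :
    (G.edist v w : ℝ≥0∞) ≤ x.distToVertex v + x.distToVertex w := by
  simp only [distToVertex, ENNReal.iInf_add, ENNReal.add_iInf]
  refine le_iInf₂ fun b hb => le_iInf₂ fun a ha => ?_
  have key : (G.edist a b : ℝ≥0∞) ≤
      ENNReal.ofReal (1 - x.coord a) + ENNReal.ofReal (1 - x.coord b) := by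
    by_cases hab : a = b
    · subst hab; simp
    · have hadj : G.Adj a b := by
        rcases x.vertex_or_edge with ⟨c, _, h2⟩ | ⟨c, d, hcd, _, h2⟩
        · have e1 : a = c := by by_contra h; exact ha (h2 a h)
          have e2 : b = c := by by_contra h; exact hb (h2 b h)
          exact absurd (e1.trans e2.symm) hab
        · have e1 : a = c ∨ a = d := by
            by_contra! h; exact ha (h2 a h.1 h.2)
          have e2 : b = c ∨ b = d := by
            by_contra! h; exact hb (h2 b h.1 h.2)
          rcases e1 with rfl | rfl <;> rcases e2 with rfl | rfl
          · exact absurd rfl hab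
          · exact hcd
          · exact hcd.symm
          · exact absurd rfl hab
      have h1 : G.edist a b = 1 := SimpleGraph.edist_eq_one_iff_adj.mpr hadj
      rw [h1, ← ENNReal.ofReal_add (by linarith [x.coord_le_one a])
        (by linarith [x.coord_le_one b])]
      have := x.coord_add_le_one hab
      simp only [ENat.toENNReal_one]
      rw [← ENNReal.ofReal_one]
      exact ENNReal.ofReal_le_ofReal (by linarith)
  calc (G.edist v w : ℝ≥0∞)
      ≤ (G.edist v a : ℝ≥0∞) + ((G.edist a b : ℝ≥0∞) + (G.edist b w : ℝ≥0∞)) :=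
        (edist_triangle_coe v a w).trans (by gcongr; exact edist_triangle_coe a b w)
    _ ≤ (G.edist v a : ℝ≥0∞) + ((ENNReal.ofReal (1 - x.coord a) +
          ENNReal.ofReal (1 - x.coord b)) + (G.edist b w : ℝ≥0∞)) := by gcongr
    _ = _ := by rw [SimpleGraph.edist_comm (u := v) (v := a)]; ring

/-- On an edge `[u, v]` through `x`, the distance to `u` is at most the length along the edge. -/
theorem distToVertex_le_of_onEdge {x : G.Realization} {u v : V} (h : x.OnEdge u v) (w : V) :
    x.distToVertex w ≤ ENNReal.ofReal (1 - x.coord u) + (G.edist u w : ℝ≥0∞) := by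
  by_cases hu : x.coord u = 0
  · have hv : x.coord v = 1 := by linarith [h.add_eq_one]
    refine (iInf₂_le v (by rw [hv]; exact one_ne_zero)).trans ?_
    rw [hv, hu]
    have h1 : G.edist v u = 1 := SimpleGraph.edist_eq_one_iff_adj.mpr h.1.symm
    have := edist_triangle_coe (G := G) v u w
    rw [h1] at this
    simpa using this
  · exact iInf₂_le u hu

theorem distInEdge_comm (x y : G.Realization) : distInEdge x y = distInEdge y x := by
  have key : ∀ a b : G.Realization, distInEdge a b ≤ distInEdge b a := fun a b =>
    le_iInf fun u => le_iInf fun v => le_iInf fun hb => le_iInf fun ha =>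
      (iInf_le_of_le u (iInf_le_of_le v (iInf_le_of_le ha (iInf_le_of_le hb
        (by rw [abs_sub_comm])))))
  exact le_antisymm (key x y) (key y x)

theorem distInEdge_le {x y : G.Realization} {u v : V} (hx : x.OnEdge u v) (hy : y.OnEdge u v) :
    distInEdge x y ≤ ENNReal.ofReal |x.coord u - y.coord u| :=
  iInf_le_of_le u (iInf_le_of_le v (iInf_le_of_le hx (iInf_le_of_le hy le_rfl)))

theorem distToVertex_le_distInEdge_add (x y : G.Realization) (w : V) :
    x.distToVertex w ≤ distInEdge x y + y.distToVertex w := by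
  rw [distToVertex.eq_1 y]
  simp only [distInEdge, ENNReal.iInf_add, ENNReal.add_iInf]
  refine le_iInf₂ fun a ha =>
    le_iInf fun u => le_iInf fun v => le_iInf fun hx => le_iInf fun hy => ?_
  rw [← add_assoc]
  have sx := hx.add_eq_one
  have sy := hy.add_eq_one
  have hcase : a = u ∨ a = v := by
    by_contra! h; exact ha (hy.2 a h.1 h.2)
  rcases hcase with rfl | rfl
  · refine (distToVertex_le_of_onEdge hx w).trans ?_
    gcongr
    rw [← ENNReal.ofReal_add (abs_nonneg _) (by linarith [y.coord_le_one a])]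
    exact ENNReal.ofReal_le_ofReal (by linarith [neg_abs_le (x.coord a - y.coord a)])
  · refine (distToVertex_le_of_onEdge hx.symm w).trans ?_
    gcongr
    rw [← ENNReal.ofReal_add (abs_nonneg _) (by linarith [y.coord_le_one a])]
    exact ENNReal.ofReal_le_ofReal (by linarith [le_abs_self (x.coord u - y.coord u)])

theorem abs_coord_sub_le_edist (x y : G.Realization) (w : V) :
    ENNReal.ofReal |x.coord w - y.coord w| ≤ EDist.edist x y := by
  rw [edist_def]
  refine le_min ?_ (le_iInf fun v => ?_)
  · refine le_iInf fun u => le_iInf fun v => le_iInf fun hx => le_iInf fun hy => ?_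
    apply ENNReal.ofReal_le_ofReal
    have sx := hx.add_eq_one
    have sy := hy.add_eq_one
    by_cases hu : w = u
    · rw [hu]
    · by_cases hv : w = v
      · subst hv
        rw [show x.coord w - y.coord w = -(x.coord u - y.coord u) by linarith, abs_neg]
      · rw [hx.2 w hu hv, hy.2 w hu hv]; simp
  · refine le_trans ?_ (add_le_add (le_distToVertex x v) (le_distToVertex y v))
    rw [← ENNReal.ofReal_add (by linarith [x.coord_le_one v]) (by linarith [y.coord_le_one v])]
    apply ENNReal.ofReal_le_ofReal
    have hx1 := x.coord_le_one v
    have hy1 := y.coord_le_one v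
    rw [abs_le]
    by_cases hw : w = v
    · subst hw; constructor <;> linarith
    · have a1 := x.coord_add_le_one hw
      have a2 := y.coord_add_le_one hw
      have a3 := x.coord_nonneg w
      have a4 := y.coord_nonneg w
      constructor <;> linarith

theorem edist_self' (x : G.Realization) : EDist.edist x x = 0 := by
  rw [edist_def, ← nonpos_iff_eq_zero]
  rcases x.vertex_or_edge with ⟨v, h1, h2⟩ | ⟨u, v, hadj, h1, h2⟩
  · refine min_le_of_right_le (iInf_le_of_le v ?_)
    have : x.distToVertex v ≤ 0 :=
      (iInf₂_le v (by rw [h1]; exact one_ne_zero)).trans (by simp [h1])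
    simpa using add_le_add this this
  · refine min_le_of_left_le ((distInEdge_le (u := u) (v := v) ⟨hadj, h2⟩ ⟨hadj, h2⟩).trans ?_)
    simp

theorem edist_comm' (x y : G.Realization) : EDist.edist x y = EDist.edist y x := by
  rw [edist_def, edist_def, distInEdge_comm]
  simp only [add_comm]

/-- Two segments in edges that meet at a point. -/
theorem edist_le_distInEdge_add (x y z : G.Realization) :
    EDist.edist x z ≤ distInEdge x y + distInEdge y z := by
  conv_rhs => simp only [distInEdge, ENNReal.iInf_add, ENNReal.add_iInf]
  refine le_iInf fun a => le_iInf fun b => le_iInf fun hy' => le_iInf fun hz =>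
    le_iInf fun u => le_iInf fun v => le_iInf fun hx => le_iInf fun hy => ?_
  have sy := hy.add_eq_one
  have sx := hx.add_eq_one
  have sz := hz.add_eq_one
  have sy' := hy'.add_eq_one
  -- if the two edges agree
  have same : ∀ c d, x.OnEdge c d → y.OnEdge c d → z.OnEdge c d →
      EDist.edist x z ≤ ENNReal.ofReal |x.coord c - y.coord c| +
        ENNReal.ofReal |y.coord c - z.coord c| := fun c d h1 _ h3 => by
    refine (min_le_left _ _).trans ((distInEdge_le h1 h3).trans ?_)
    rw [← ENNReal.ofReal_add (abs_nonneg _) (abs_nonneg _)]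
    exact ENNReal.ofReal_le_ofReal (abs_sub_le _ _ _)
  -- if the middle point is a vertex
  have vert : ∀ q, y.coord q = 1 → EDist.edist x z ≤ ENNReal.ofReal |x.coord u - y.coord u| +
      ENNReal.ofReal |y.coord a - z.coord a| := fun q hq => by
    have h0 : y.distToVertex q ≤ 0 :=
      (iInf₂_le q (by rw [hq]; exact one_ne_zero)).trans (by simp [hq])
    refine (min_le_right _ _).trans (iInf_le_of_le q ?_)
    have e1 := distToVertex_le_distInEdge_add x y q
    have e2 := distToVertex_le_distInEdge_add z y q
    rw [nonpos_iff_eq_zero.mp h0, add_zero] at e1 e2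
    rw [distInEdge_comm] at e2
    exact add_le_add (e1.trans (distInEdge_le hx hy)) (e2.trans (distInEdge_le hy' hz))
  by_cases hua : u = a
  · subst hua
    by_cases hvb : v = b
    · subst hvb; exact same u v hx hy hz
    · have : y.coord v = 0 := hy'.2 v hx.1.ne.symm hvb
      exact vert u (by linarith)
  · by_cases hub : u = b
    · subst hub
      by_cases hva : v = a
      · subst hva
        have := same u v hx hy hz.symm
        rwa [show y.coord u - z.coord u = -(y.coord v - z.coord v) by linarith, abs_neg] at this
      · have : y.coord v = 0 := hy'.2 v hva hx.1.ne.symm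
        exact vert u (by linarith)
    · have : y.coord u = 0 := hy'.2 u hua hub
      exact vert v (by linarith)

theorem edist_triangle' (x y z : G.Realization) : EDist.edist x z ≤ EDist.edist x y + EDist.edist y z := by
  rw [edist_def x y, edist_def y z]
  rcases min_choice (distInEdge x y) (⨅ v : V, (x.distToVertex v + y.distToVertex v)) with h | h <;>
  rcases min_choice (distInEdge y z) (⨅ v : V, (y.distToVertex v + z.distToVertex v)) with h' | h'
    <;> rw [h, h']
  · exact edist_le_distInEdge_add x y z
  · rw [ENNReal.add_iInf]
    refine le_iInf fun w => (min_le_right _ _).trans (iInf_le_of_le w ?_)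
    rw [← add_assoc]
    gcongr
    exact distToVertex_le_distInEdge_add x y w
  · rw [ENNReal.iInf_add]
    refine le_iInf fun w => (min_le_right _ _).trans (iInf_le_of_le w ?_)
    rw [add_assoc, add_comm (y.distToVertex w)]
    gcongr
    rw [distInEdge_comm]
    exact distToVertex_le_distInEdge_add z y w
  · rw [ENNReal.iInf_add]
    refine le_iInf fun v => ?_
    rw [ENNReal.add_iInf]
    refine le_iInf fun w => (min_le_right _ _).trans (iInf_le_of_le w ?_)
    calc x.distToVertex w + z.distToVertex w
        ≤ (x.distToVertex v + (G.edist v w : ℝ≥0∞)) + z.distToVertex w := by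
          gcongr; exact distToVertex_le_add x v w
      _ ≤ (x.distToVertex v + (y.distToVertex v + y.distToVertex w)) + z.distToVertex w := by
          gcongr; exact edist_le_distToVertex_add y v w
      _ = _ := by ring

noncomputable instance : EMetricSpace G.Realization where
  edist_self := edist_self'
  edist_comm := edist_comm'
  edist_triangle := edist_triangle'
  eq_of_edist_eq_zero {x y} h := by
    ext w
    have h1 := abs_coord_sub_le_edist x y w
    rw [h, nonpos_iff_eq_zero, ENNReal.ofReal_eq_zero] at h1
    linarith [abs_eq_zero.mp (le_antisymm h1 (abs_nonneg _))]

end Realization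

/-- The corona of `G₁` and `G₂`: one copy of `G₁` (the vertices `inl v`), one copy of `G₂` for each
vertex `v` of `G₁` (the vertices `inr (v, a)`), and each vertex `v` of `G₁` is joined to every vertex
of the copy of `G₂` that belongs to `v`. -/
def corona {V₁ V₂ : Type*} (G₁ : SimpleGraph V₁) (G₂ : SimpleGraph V₂) :
    SimpleGraph (V₁ ⊕ V₁ × V₂) where
  Adj
    | Sum.inl u, Sum.inl v => G₁.Adj u v
    | Sum.inl u, Sum.inr (v, _) => u = v
    | Sum.inr (u, _), Sum.inl v => u = v
    | Sum.inr (u, a), Sum.inr (v, b) => u = v ∧ G₂.Adj a b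
  symm := ⟨by
    rintro (u | ⟨u, a⟩) (v | ⟨v, b⟩) h
    · exact G₁.adj_symm h
    · exact Eq.symm h
    · exact Eq.symm h
    · exact ⟨h.1.symm, h.2.symm⟩⟩
  loopless := ⟨by
    rintro (u | ⟨u, a⟩) h
    · exact G₁.loopless.irrefl u h
    · exact G₂.loopless.irrefl a h.2⟩

end SimpleGraph

/-! ### Hyperbolicity constants -/

section Hyperbolicity

variable {X Y : Type*} [EMetricSpace X] [EMetricSpace Y]

/-! The corona is $G_1$ with a cone over $G_2$ glued on at each vertex $v$, so $v$ separates its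
cone from everything else. Collapsing every cone to its apex therefore retracts the corona onto
$G_1$, which sits in it isometrically. A point moves by at most $3/2$, and a path leaving its fibre
must pass through the apex. `IsCutRetraction` records exactly these facts, and
`isCutRetraction_ofCorona` verifies them.

The lower bound holds because an isometric embedding carries geodesic triangles to geodesic
triangles with the same thinness.

For the upper bound, take a side of a triangle in the corona. If its ends lie in different fibres,
it is a geodesic of $G_1$ extended at both ends by pieces of length at most $3/2$
(`exists_isGeodesicSegment`). If they lie in one fibre, its length is at most $3$. A point outside
the $G_1$ part is thus within $3/2$ of a corner, and each corner lies on another side. A point of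
the $G_1$ part lies on a side of the projected triangle in $G_1$, whose other two sides are
contained in the union of the original ones, so $\delta(G_1)$ bounds its distance to them
(`infEDist_le`). -/

/-- Thinness consists of non-strict upper bounds on distances, so it passes to the infimum of the
admissible `δ`: the infimum is attained. -/
theorem GeodesicTriangle.thinConst_le_iff {T : GeodesicTriangle X} {δ : ℝ≥0} :
    T.thinConst ≤ δ ↔ T.IsThin δ := by
  refine ⟨fun h => ?_, fun h => iInf₂_le δ h⟩
  have key : ∀ a : ℝ≥0∞, (∀ ε : ℝ≥0, T.IsThin ε → a ≤ ε) → a ≤ δ := fun a ha =>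
    (le_iInf₂ ha).trans h
  exact ⟨fun p hp => key _ fun ε hε => hε.1 p hp, fun p hp => key _ fun ε hε => hε.2.1 p hp,
    fun p hp => key _ fun ε hε => hε.2.2 p hp⟩

theorem hyperbolicityConst_le_iff {δ : ℝ≥0} :
    hyperbolicityConst X ≤ δ ↔ IsDeltaHyperbolic X δ := by
  simp only [hyperbolicityConst, iSup_le_iff, GeodesicTriangle.thinConst_le_iff,
    IsDeltaHyperbolic]

theorem IsGeodesicSegment.left_mem {x y : X} {S : Set X} (h : IsGeodesicSegment x y S) :
    x ∈ S := by
  obtain ⟨L, γ, hL, h0, -, -, rfl⟩ := h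
  exact ⟨0, ⟨le_rfl, hL⟩, h0⟩

theorem IsGeodesicSegment.right_mem {x y : X} {S : Set X} (h : IsGeodesicSegment x y S) :
    y ∈ S := by
  obtain ⟨L, γ, hL, -, h1, -, rfl⟩ := h
  exact ⟨L, ⟨hL, le_rfl⟩, h1⟩

theorem isGeodesicSegment_singleton (x : X) : IsGeodesicSegment x x {x} := by
  refine ⟨0, fun _ => x, le_rfl, rfl, rfl, fun s hs t ht => ?_, by simp⟩
  have hs' : s = 0 := le_antisymm hs.2 hs.1
  have ht' : t = 0 := le_antisymm ht.2 ht.1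
  simp [hs', ht']

theorem IsGeodesicSegment.image {f : Y → X} (hf : Isometry f) {x y : Y} {S : Set Y}
    (h : IsGeodesicSegment x y S) : IsGeodesicSegment (f x) (f y) (f '' S) := by
  obtain ⟨L, γ, hL, rfl, rfl, h2, rfl⟩ := h
  refine ⟨L, f ∘ γ, hL, rfl, rfl, fun s hs t ht => ?_, (Set.image_comp _ _ _).symm⟩
  rw [← h2 s hs t ht]
  exact hf _ _

/-- The image of a geodesic triangle under an isometric embedding. -/
def GeodesicTriangle.map {f : Y → X} (hf : Isometry f) (T : GeodesicTriangle Y) :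
    GeodesicTriangle X where
  p₁ := f T.p₁
  p₂ := f T.p₂
  p₃ := f T.p₃
  side₁₂ := f '' T.side₁₂
  side₂₃ := f '' T.side₂₃
  side₃₁ := f '' T.side₃₁
  isGeodesic₁₂ := T.isGeodesic₁₂.image hf
  isGeodesic₂₃ := T.isGeodesic₂₃.image hf
  isGeodesic₃₁ := T.isGeodesic₃₁.image hf

theorem GeodesicTriangle.isThin_map {f : Y → X} (hf : Isometry f) {T : GeodesicTriangle Y}
    {δ : ℝ≥0} : (T.map hf).IsThin δ ↔ T.IsThin δ := by
  simp only [IsThin, map, Set.forall_mem_image, ← Set.image_union, Metric.infEDist_image hf]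

theorem IsDeltaHyperbolic.of_isometry {f : Y → X} (hf : Isometry f) {δ : ℝ≥0}
    (h : IsDeltaHyperbolic X δ) : IsDeltaHyperbolic Y δ := fun T =>
  (GeodesicTriangle.isThin_map hf).mp (h (T.map hf))

theorem hyperbolicityConst_le_of_isometry {f : Y → X} (hf : Isometry f) :
    hyperbolicityConst Y ≤ hyperbolicityConst X := by
  by_cases htop : hyperbolicityConst X = ⊤
  · rw [htop]; exact le_top
  · rw [← ENNReal.coe_toNNReal htop, hyperbolicityConst_le_iff]
    refine IsDeltaHyperbolic.of_isometry hf (hyperbolicityConst_le_iff.mp ?_)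
    rw [ENNReal.coe_toNNReal htop]

end Hyperbolicity

/-! ### Retractions that collapse small pieces attached at cut points -/

section CutRetraction

variable {X Y : Type*} [EMetricSpace X] [EMetricSpace Y]

/-- `r` is a retraction of `X` onto the isometric image of `Y` under `ι` which moves points by at
most `C`, and every point `x` is separated by `ι (r x)` from the points outside its fibre. -/
structure IsCutRetraction (ι : Y → X) (r : X → Y) (C : ℝ≥0) : Prop where
  isometry : Isometry ι
  leftInverse : Function.LeftInverse r ι
  edist_le : ∀ x, edist x (ι (r x)) ≤ C
  edist_eq_add : ∀ x y, r x ≠ r y → edist x y = edist x (ι (r x)) + edist (ι (r x)) y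

namespace IsCutRetraction

variable {ι : Y → X} {r : X → Y} {C : ℝ≥0}

/-- The separation property is applied twice: to leave the fibre of `x`, and then, read backwards
from `y`, to enter the fibre of `y`. -/
theorem edist_eq (hr : IsCutRetraction ι r C) {x y : X} (h : r x ≠ r y) :
    edist x y = edist x (ι (r x)) + edist (r x) (r y) + edist y (ι (r y)) := by
  rw [hr.edist_eq_add x y h, edist_comm (ι (r x)) y,
    hr.edist_eq_add y (ι (r x)) (by rw [hr.leftInverse]; exact h.symm), hr.isometry.edist_eq,
    edist_comm (r y)]
  ring

/-- The real-valued form of `IsCutRetraction.edist_eq`. -/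
theorem toReal_edist_eq (hr : IsCutRetraction ι r C) {x y : X} (h : r x ≠ r y) {l : ℝ}
    (hl : 0 ≤ l) (hxy : edist x y = ENNReal.ofReal l) :
    edist (r x) (r y) ≠ ⊤ ∧ 0 < (edist (r x) (r y)).toReal ∧
      l = (edist x (ι (r x))).toReal + (edist (r x) (r y)).toReal +
        (edist y (ι (r y))).toReal := by
  have hx : edist x (ι (r x)) ≠ ⊤ := ((hr.edist_le x).trans_lt ENNReal.coe_lt_top).ne
  have hy : edist y (ι (r y)) ≠ ⊤ := ((hr.edist_le y).trans_lt ENNReal.coe_lt_top).ne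
  have e := hr.edist_eq h
  have hd : edist (r x) (r y) ≠ ⊤ := by
    intro ht
    rw [ht, hxy] at e
    simp at e
  refine ⟨hd, ENNReal.toReal_pos (by simpa using h) hd, ?_⟩
  rw [← ENNReal.toReal_add hx hd, ← ENNReal.toReal_add (by simp [hx, hd]) hy, ← e, hxy,
    ENNReal.toReal_ofReal hl]

/-- A geodesic between points of different fibres runs through a geodesic of `Y`, except for two
pieces of length at most `C` at its ends. -/
theorem exists_isGeodesicSegment (hr : IsCutRetraction ι r C) {x y : X} {S : Set X}
    (hS : IsGeodesicSegment x y S) (h : r x ≠ r y) :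
    ∃ S', IsGeodesicSegment (r x) (r y) S' ∧ ι '' S' ⊆ S ∧
      ∀ p ∈ S, p ∈ ι '' S' ∨ edist p x ≤ C ∨ edist p y ≤ C := by
  obtain ⟨L, γ, hL, h0, h1, hγ, rfl⟩ := hS
  have fin : ∀ p, edist p (ι (r p)) ≠ ⊤ := fun p =>
    ((hr.edist_le p).trans_lt ENNReal.coe_lt_top).ne
  have nn : ∀ p, 0 ≤ (edist p (ι (r p))).toReal := fun p => ENNReal.toReal_nonneg
  have dl : ∀ t ∈ Set.Icc 0 L, edist (γ t) x = ENNReal.ofReal t := fun t ht => by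
    rw [← h0, hγ t ht 0 ⟨le_rfl, hL⟩, sub_zero, abs_of_nonneg ht.1]
  have dr : ∀ t ∈ Set.Icc 0 L, edist (γ t) y = ENNReal.ofReal (L - t) := fun t ht => by
    rw [← h1, hγ t ht L ⟨hL, le_rfl⟩, abs_sub_comm, abs_of_nonneg (by linarith [ht.2])]
  have dxy : edist x y = ENNReal.ofReal L := by
    rw [← h0, dr 0 ⟨le_rfl, hL⟩, sub_zero]
  obtain ⟨hDfin, hD, hLe⟩ := hr.toReal_edist_eq h hL dxy
  -- The length splits as `L = a + D + b`. The three cases below show that `γ` lies in the image of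
  -- `ι` exactly as needed on the parameter interval `[a, a + D]`.
  set a := (edist x (ι (r x))).toReal with ha
  set b := (edist y (ι (r y))).toReal with hb
  set D := (edist (r x) (r y)).toReal with hDdef
  have ha0 : 0 ≤ a := nn x
  have hb0 : 0 ≤ b := nn y
  have caseL : ∀ t ∈ Set.Icc 0 L, r (γ t) = r x →
      t = a - (edist (γ t) (ι (r (γ t)))).toReal := fun t ht e => by
    have := (hr.toReal_edist_eq (by rw [e]; exact h) (by linarith [ht.2]) (dr t ht)).2.2
    rw [e, ← hDdef, ← hb] at this
    rw [e]
    linarith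
  have caseR : ∀ t ∈ Set.Icc 0 L, r (γ t) = r y →
      t = a + D + (edist (γ t) (ι (r (γ t)))).toReal := fun t ht e => by
    have := (hr.toReal_edist_eq (by rw [e]; exact h.symm) ht.1 (dl t ht)).2.2
    rw [e, edist_comm (r y), ← hDdef, ← ha] at this
    rw [e]
    linarith
  -- Adding the decompositions of `t` and `L - t` counts the distance from `γ t` to its projection
  -- twice. The triangle inequality in `Y` leaves no room for it, so it vanishes.
  have caseM : ∀ t ∈ Set.Icc 0 L, r (γ t) ≠ r x → r (γ t) ≠ r y →
      (edist (γ t) (ι (r (γ t)))).toReal = 0 ∧ a < t ∧ t < a + D := fun t ht e1 e2 => by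
    obtain ⟨f1, p1, q1⟩ := hr.toReal_edist_eq e1 ht.1 (dl t ht)
    obtain ⟨f2, p2, q2⟩ := hr.toReal_edist_eq e2 (by linarith [ht.2]) (dr t ht)
    have tri : D ≤ (edist (r (γ t)) (r x)).toReal + (edist (r (γ t)) (r y)).toReal := by
      rw [← ENNReal.toReal_add f1 f2, hDdef]
      refine ENNReal.toReal_mono (by simp [f1, f2]) ?_
      rw [edist_comm _ (r x)]
      exact edist_triangle _ _ _
    have := nn (γ t)
    refine ⟨by linarith, by linarith, by linarith⟩
  have mid : ∀ t ∈ Set.Icc a (a + D), γ t = ι (r (γ t)) := fun t ht => by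
    have ht' : t ∈ Set.Icc 0 L := ⟨by linarith [ht.1], by linarith [ht.2]⟩
    have n := nn (γ t)
    have z : (edist (γ t) (ι (r (γ t)))).toReal = 0 := by
      by_cases e1 : r (γ t) = r x
      · linarith [caseL t ht' e1, ht.1]
      · by_cases e2 : r (γ t) = r y
        · linarith [caseR t ht' e2, ht.2]
        · exact (caseM t ht' e1 e2).1
    exact edist_eq_zero.mp (((ENNReal.toReal_eq_zero_iff _).mp z).resolve_right (fin _))
  have maIcc : a ∈ Set.Icc 0 L := ⟨ha0, by linarith⟩
  have mbIcc : a + D ∈ Set.Icc 0 L := ⟨by linarith, by linarith⟩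
  have sub : ∀ s ∈ Set.Icc 0 D, a + s ∈ Set.Icc a (a + D) ∧ a + s ∈ Set.Icc 0 L := fun s hs =>
    ⟨⟨by linarith [hs.1], by linarith [hs.2]⟩, ⟨by linarith [hs.1], by linarith [hs.2]⟩⟩
  -- The geodesic of `Y` is the middle stretch of `γ`, reparametrized from `0`. At its two ends the
  -- cases for the wrong fibre are excluded by `0 < D` or by the strict bounds of `caseM`.
  refine ⟨(fun s => r (γ (a + s))) '' Set.Icc 0 D,
    ⟨D, fun s => r (γ (a + s)), hD.le, ?_, ?_, ?_, rfl⟩, ?_, ?_⟩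
  · simp only [add_zero]
    by_contra e1
    by_cases e2 : r (γ a) = r y
    · linarith [caseR a maIcc e2, nn (γ a)]
    · linarith [(caseM a maIcc e1 e2).2.1]
  · by_contra e2
    by_cases e1 : r (γ (a + D)) = r x
    · linarith [caseL _ mbIcc e1, nn (γ (a + D))]
    · linarith [(caseM _ mbIcc e1 e2).2.2]
  · intro s hs t ht
    simp only
    rw [← hr.isometry.edist_eq, ← mid _ (sub s hs).1, ← mid _ (sub t ht).1,
      hγ _ (sub s hs).2 _ (sub t ht).2]
    congr 2
    ring
  · rintro _ ⟨_, ⟨s, hs, rfl⟩, rfl⟩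
    exact ⟨a + s, (sub s hs).2, mid _ (sub s hs).1⟩
  · rintro _ ⟨t, ht, rfl⟩
    rcases lt_or_ge t a with hta | hta
    · refine Or.inr (Or.inl ?_)
      rw [dl t ht]
      refine le_trans ?_ (hr.edist_le x)
      rw [← ENNReal.ofReal_toReal (fin x)]
      exact ENNReal.ofReal_le_ofReal hta.le
    rcases lt_or_ge (a + D) t with htb | htb
    · refine Or.inr (Or.inr ?_)
      rw [dr t ht]
      refine le_trans ?_ (hr.edist_le y)
      rw [← ENNReal.ofReal_toReal (fin y)]
      exact ENNReal.ofReal_le_ofReal (by linarith)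
    · refine Or.inl ⟨_, ⟨t - a, ⟨by linarith, by linarith⟩, rfl⟩, ?_⟩
      simp only [add_sub_cancel]
      exact (mid t ⟨hta, htb⟩).symm

/-- Going through the common projection bounds the length of `S` by `2C`, so the nearer end is
within `C`. -/
theorem edist_le_of_mem_of_eq (hr : IsCutRetraction ι r C) {x y p : X} {S : Set X}
    (hS : IsGeodesicSegment x y S) (h : r x = r y) (hp : p ∈ S) :
    edist p x ≤ C ∨ edist p y ≤ C := by
  obtain ⟨L, γ, hL, h0, h1, hγ, rfl⟩ := hS
  obtain ⟨t, ht, rfl⟩ := hp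
  have hLC : L ≤ C + C := by
    have e : edist x y ≤ C + C := (edist_triangle x (ι (r x)) y).trans
      (add_le_add (hr.edist_le x) (by rw [edist_comm, h]; exact hr.edist_le y))
    rw [← h0, ← h1, hγ 0 ⟨le_rfl, hL⟩ L ⟨hL, le_rfl⟩, zero_sub, abs_neg, abs_of_nonneg hL,
      ← ENNReal.coe_add, ← ENNReal.ofReal_coe_nnreal,
      ENNReal.ofReal_le_ofReal_iff NNReal.zero_le_coe] at e
    simpa using e
  rcases le_total t C with htC | htC
  · left
    rw [← h0, hγ t ht 0 ⟨le_rfl, hL⟩, sub_zero, abs_of_nonneg ht.1, ← ENNReal.ofReal_coe_nnreal]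
    exact ENNReal.ofReal_le_ofReal htC
  · right
    rw [← h1, hγ t ht L ⟨hL, le_rfl⟩, abs_sub_comm, abs_of_nonneg (by linarith [ht.2]),
      ← ENNReal.ofReal_coe_nnreal]
    exact ENNReal.ofReal_le_ofReal (by linarith)

/-- Lets degenerate sides enter the projected triangle: when both ends have the same projection, `S`
need not meet the image of `ι`, and a constant geodesic is used instead. -/
theorem exists_isGeodesicSegment_subset (hr : IsCutRetraction ι r C) {x y : X} {S : Set X}
    (hS : IsGeodesicSegment x y S) :
    ∃ S', IsGeodesicSegment (r x) (r y) S' ∧ (r x ≠ r y → ι '' S' ⊆ S) ∧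
      (r x = r y → S' = {r x}) := by
  by_cases h : r x = r y
  · exact ⟨{r x}, h ▸ isGeodesicSegment_singleton _, fun h' => absurd h h', fun _ => rfl⟩
  · obtain ⟨S', h1, h2, -⟩ := hr.exists_isGeodesicSegment hS h
    exact ⟨S', h1, fun _ => h2, fun h' => absurd h' h⟩

theorem infEDist_le (hr : IsCutRetraction ι r C) {δ : ℝ≥0} (hδ : IsDeltaHyperbolic Y δ)
    {x y z : X} {A B D : Set X} (hA : IsGeodesicSegment x y A) (hB : IsGeodesicSegment y z B)
    (hD : IsGeodesicSegment z x D) {p : X} (hp : p ∈ A) :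
    Metric.infEDist p (B ∪ D) ≤ (max δ C : ℝ≥0) := by
  have near : edist p x ≤ C ∨ edist p y ≤ C → Metric.infEDist p (B ∪ D) ≤ (max δ C : ℝ≥0) := by
    have hC : (C : ℝ≥0∞) ≤ (max δ C : ℝ≥0) := by exact_mod_cast le_max_right δ C
    rintro (h | h)
    · exact (Metric.infEDist_le_edist_of_mem (Set.mem_union_right B hD.right_mem)).trans (h.trans hC)
    · exact (Metric.infEDist_le_edist_of_mem (Set.mem_union_left D hB.left_mem)).trans (h.trans hC)
  by_cases hxy : r x = r y
  · exact near (hr.edist_le_of_mem_of_eq hA hxy hp)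
  obtain ⟨A', hA', -, hA3⟩ := hr.exists_isGeodesicSegment hA hxy
  rcases hA3 p hp with ⟨q, hq, rfl⟩ | hn
  swap
  · exact near hn
  obtain ⟨B', hB', hB1, hB2⟩ := hr.exists_isGeodesicSegment_subset hB
  obtain ⟨D', hD', hD1, hD2⟩ := hr.exists_isGeodesicSegment_subset hD
  have sub : ι '' (B' ∪ D') ⊆ B ∪ D := by
    rw [Set.image_union]
    -- As `r x ≠ r y`, at most one of the other projected sides is degenerate. Its single point is
    -- then an end of the other one, which does lift into its side.
    by_cases hyz : r y = r z
    · have hD := hD1 fun e => hxy (hyz.trans e).symm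
      rw [hB2 hyz, Set.image_singleton, hyz]
      exact (Set.union_subset (Set.singleton_subset_iff.mpr (hD ⟨_, hD'.left_mem, rfl⟩)) hD).trans
        Set.subset_union_right
    · have hB := hB1 hyz
      by_cases hzx : r z = r x
      · rw [hD2 hzx, Set.image_singleton]
        exact (Set.union_subset hB (Set.singleton_subset_iff.mpr
          (hB ⟨_, hB'.right_mem, rfl⟩))).trans Set.subset_union_left
      · exact Set.union_subset_union hB (hD1 hzx)
  refine (Metric.infEDist_anti sub).trans ?_
  rw [Metric.infEDist_image hr.isometry]
  calc Metric.infEDist q (B' ∪ D') ≤ δ := (hδ ⟨_, _, _, A', B', D', hA', hB', hD'⟩).1 q hq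
    _ ≤ (max δ C : ℝ≥0) := by exact_mod_cast le_max_left δ C

theorem isDeltaHyperbolic (hr : IsCutRetraction ι r C) {δ : ℝ≥0} (hδ : IsDeltaHyperbolic Y δ) :
    IsDeltaHyperbolic X (max δ C) := fun T =>
  ⟨fun _ hp => hr.infEDist_le hδ T.isGeodesic₁₂ T.isGeodesic₂₃ T.isGeodesic₃₁ hp,
    fun _ hp => hr.infEDist_le hδ T.isGeodesic₂₃ T.isGeodesic₃₁ T.isGeodesic₁₂ hp,
    fun _ hp => hr.infEDist_le hδ T.isGeodesic₃₁ T.isGeodesic₁₂ T.isGeodesic₂₃ hp⟩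

theorem isHyperbolic_iff (hr : IsCutRetraction ι r C) : IsHyperbolic X ↔ IsHyperbolic Y :=
  ⟨fun ⟨δ, h⟩ => ⟨δ, h.of_isometry hr.isometry⟩, fun ⟨δ, h⟩ => ⟨max δ C, hr.isDeltaHyperbolic h⟩⟩

theorem hyperbolicityConst_le (hr : IsCutRetraction ι r C) :
    hyperbolicityConst X ≤ max (hyperbolicityConst Y) C := by
  by_cases htop : hyperbolicityConst Y = ⊤
  · rw [htop]; simp
  · lift hyperbolicityConst Y to ℝ≥0 using htop with δ hδ
    rw [← ENNReal.coe_max, hyperbolicityConst_le_iff]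
    exact hr.isDeltaHyperbolic (hyperbolicityConst_le_iff.mp hδ.ge)

end IsCutRetraction

end CutRetraction

/-! ### Cut vertices of a graph and of its realization -/

namespace SimpleGraph

section CutVertex

variable {V : Type*} {G : SimpleGraph V}

/-- The vertex sets `A` and `B` cover the graph, and every edge lies in `A` or in `B`; they meet
at most in `c`. -/
structure IsSeparatedAt (G : SimpleGraph V) (c : V) (A B : Set V) : Prop where
  eq_of_mem : ∀ u, u ∈ A → u ∈ B → u = c
  mem_or_mem : ∀ u, u ∈ A ∨ u ∈ B
  edge : ∀ u v, G.Adj u v → (u ∈ A ∧ v ∈ A) ∨ (u ∈ B ∧ v ∈ B)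

theorem IsSeparatedAt.symm {c : V} {A B : Set V} (h : G.IsSeparatedAt c A B) :
    G.IsSeparatedAt c B A :=
  ⟨fun u hA hB => h.eq_of_mem u hB hA, fun u => (h.mem_or_mem u).symm,
    fun u v huv => (h.edge u v huv).symm⟩

/-- A walk from `A` to `B` must visit `c`. By induction on the walk: either its first edge stays in
`A`, or its first vertex lies in both sets and is `c`. -/
theorem IsSeparatedAt.edist_add_edist_le {c : V} {A B : Set V} (h : G.IsSeparatedAt c A B)
    {u w : V} (hu : u ∈ A) (hw : w ∈ B) :
    G.edist u c + G.edist c w ≤ G.edist u w := by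
  refine le_iInf fun p => ?_
  induction p with
  | nil =>
    rw [h.eq_of_mem _ hu hw]
    simp
  | @cons u v w huv p ih =>
    rcases h.edge u v huv with ⟨-, hv⟩ | ⟨hu', -⟩
    · have h1 : G.edist u c ≤ 1 + G.edist v c := by
        rw [← edist_eq_one_iff_adj.mpr huv]
        exact SimpleGraph.edist_triangle
      calc G.edist u c + G.edist c w ≤ 1 + G.edist v c + G.edist c w := by gcongr
        _ = (G.edist v c + G.edist c w) + 1 := by ring
        _ ≤ p.length + 1 := by gcongr; exact ih hv hw
        _ = _ := by simp
    · obtain rfl := h.eq_of_mem u hu hu'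
      rw [edist_self, zero_add]
      exact edist_le _

/-! ### Distances between points of the realization across a cut vertex -/

namespace Realization

/-- A vertex as a point of the realization. -/
noncomputable def ofVertex (v : V) : G.Realization where
  coord := Set.indicator {v} 1
  coord_nonneg w := Set.indicator_nonneg (fun _ _ => zero_le_one) w
  vertex_or_edge := Or.inl ⟨v, by simp, fun w hw => by simp [hw]⟩

theorem ofVertex_coord_self (v : V) : (ofVertex v : G.Realization).coord v = 1 := by
  simp [ofVertex]

theorem ofVertex_coord_of_ne {v w : V} (h : w ≠ v) : (ofVertex v : G.Realization).coord w = 0 := by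
  simp [ofVertex, h]

theorem coord_eq_one_of_forall {x : G.Realization} {v : V} (h : ∀ w, w ≠ v → x.coord w = 0) :
    x.coord v = 1 := by
  rcases x.vertex_or_edge with ⟨a, h1, h2⟩ | ⟨a, b, hab, h1, h2⟩
  · by_cases hav : a = v
    · rw [← hav, h1]
    · linarith [h a hav]
  · by_cases hav : a = v
    · subst hav
      linarith [h b hab.ne.symm]
    · by_cases hbv : b = v
      · subst hbv
        linarith [h a hab.ne]
      · linarith [h a hav, h b hbv]

theorem eq_ofVertex {x : G.Realization} {v : V} (h : ∀ w, w ≠ v → x.coord w = 0) :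
    x = ofVertex v := by
  ext w
  by_cases hw : w = v
  · rw [hw, ofVertex_coord_self, coord_eq_one_of_forall h]
  · rw [h w hw, ofVertex_coord_of_ne hw]

theorem distToVertex_eq_zero {x : G.Realization} {v : V} (h : x.coord v = 1) :
    x.distToVertex v = 0 :=
  nonpos_iff_eq_zero.mp ((iInf₂_le v (by rw [h]; exact one_ne_zero)).trans (by simp [h]))

/-- The points whose support lies in a set of vertices. -/
def SupportedIn (x : G.Realization) (A : Set V) : Prop :=
  ∀ v, x.coord v ≠ 0 → v ∈ A

theorem SupportedIn.distToVertex_add_edist_le {c : V} {A B : Set V} (h : G.IsSeparatedAt c A B)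
    {x : G.Realization} (hx : x.SupportedIn A) {w : V} (hw : w ∈ B) :
    x.distToVertex c + (G.edist c w : ℝ≥0∞) ≤ x.distToVertex w := by
  refine le_iInf₂ fun u hu => ?_
  calc x.distToVertex c + (G.edist c w : ℝ≥0∞)
      ≤ (ENNReal.ofReal (1 - x.coord u) + (G.edist u c : ℝ≥0∞)) + (G.edist c w : ℝ≥0∞) := by
        gcongr; exact iInf₂_le u hu
    _ ≤ _ := by
        rw [add_assoc]
        gcongr
        exact_mod_cast h.edist_add_edist_le (hx u hu) hw

/-- A path through a vertex `w` crosses `c` between `w` and whichever of `x`, `y` is supported on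
the side opposite to `w`. On a common edge, contained in one side, the point supported in the other
side can only be `c`. -/
theorem edist_eq_of_isSeparatedAt {c : V} {A B : Set V} (h : G.IsSeparatedAt c A B)
    {x y : G.Realization} (hx : x.SupportedIn A) (hy : y.SupportedIn B) :
    EDist.edist x y = x.distToVertex c + y.distToVertex c := by
  refine le_antisymm ((min_le_right _ _).trans (iInf_le _ c)) (le_min ?_ (le_iInf fun w => ?_))
  · refine le_iInf fun u => le_iInf fun v => le_iInf fun hxe => le_iInf fun hye => ?_
    have vert : ∀ {z : G.Realization} {A B : Set V}, G.IsSeparatedAt c A B → z.SupportedIn B →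
        z.OnEdge u v → u ∈ A ∧ v ∈ A → z.distToVertex c = 0 := by
      intro z A B h hz he hA
      refine distToVertex_eq_zero (coord_eq_one_of_forall fun w hw => ?_)
      by_contra hne
      refine hw (h.eq_of_mem w ?_ (hz w hne))
      by_contra hwA
      exact hne (he.2 w (fun e => hwA (e ▸ hA.1)) (fun e => hwA (e ▸ hA.2)))
    rcases h.edge u v hxe.1 with hA | hB
    · rw [vert h hy hye hA, add_zero]
      refine (distToVertex_le_distInEdge_add x y c).trans ?_
      rw [vert h hy hye hA, add_zero]
      exact distInEdge_le hxe hye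
    · rw [vert h.symm hx hxe hB, zero_add]
      refine (distToVertex_le_distInEdge_add y x c).trans ?_
      rw [vert h.symm hx hxe hB, add_zero, distInEdge_comm]
      exact distInEdge_le hxe hye
  · rcases h.mem_or_mem w with hw | hw
    · calc x.distToVertex c + y.distToVertex c
          ≤ (x.distToVertex w + (G.edist w c : ℝ≥0∞)) + y.distToVertex c := by
            gcongr; exact distToVertex_le_add x w c
        _ = x.distToVertex w + (y.distToVertex c + (G.edist c w : ℝ≥0∞)) := by
            rw [SimpleGraph.edist_comm]; ring
        _ ≤ _ := by gcongr; exact hy.distToVertex_add_edist_le h.symm hw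
    · calc x.distToVertex c + y.distToVertex c
          ≤ x.distToVertex c + (y.distToVertex w + (G.edist w c : ℝ≥0∞)) := by
            gcongr; exact distToVertex_le_add y w c
        _ = (x.distToVertex c + (G.edist c w : ℝ≥0∞)) + y.distToVertex w := by
            rw [SimpleGraph.edist_comm]; ring
        _ ≤ _ := by gcongr; exact hx.distToVertex_add_edist_le h hw

theorem ofVertex_supportedIn {v : V} {A : Set V} (h : v ∈ A) :
    (ofVertex v : G.Realization).SupportedIn A := fun w hw => by
  by_cases hwv : w = v
  · exact hwv ▸ h
  · exact absurd (ofVertex_coord_of_ne hwv) hw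

theorem edist_ofVertex (x : G.Realization) (v : V) : EDist.edist x (ofVertex v) = x.distToVertex v := by
  -- The trivial separation: every vertex cuts the whole graph from itself.
  have h : G.IsSeparatedAt v Set.univ {v} :=
    ⟨fun u _ h => h, fun u => Or.inl trivial, fun u w _ => Or.inl ⟨trivial, trivial⟩⟩
  rw [edist_eq_of_isSeparatedAt h (fun _ _ => trivial) (ofVertex_supportedIn rfl),
    distToVertex_eq_zero (ofVertex_coord_self v), add_zero]

theorem exists_half_le_coord (x : G.Realization) : ∃ u, 1 / 2 ≤ x.coord u := by
  rcases x.vertex_or_edge with ⟨a, h1, -⟩ | ⟨a, b, -, h1, -⟩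
  · exact ⟨a, by rw [h1]; norm_num⟩
  · rcases le_total (1 / 2) (x.coord a) with h | h
    · exact ⟨a, h⟩
    · exact ⟨b, by linarith⟩

end Realization

end CutVertex

/-! ### The corona -/

section Corona

variable {V₁ V₂ : Type*} {G₁ : SimpleGraph V₁} {G₂ : SimpleGraph V₂}

/-- The projection of the corona that collapses each copy of `G₂` onto its vertex of `G₁`. -/
def coronaProj : V₁ ⊕ V₁ × V₂ → V₁ := Sum.elim id Prod.fst

/-- The projection sends each edge to an edge or to a single vertex, so it does not lengthen walks.
Detours through copies of `G₂` are therefore no shortcut in `G₁`. -/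
theorem edist_coronaProj_le (u w : V₁ ⊕ V₁ × V₂) :
    G₁.edist (coronaProj u) (coronaProj w) ≤ (G₁.corona G₂).edist u w := by
  refine le_iInf fun p => ?_
  induction p with
  | nil => simp
  | @cons u v w huv p ih =>
    have h1 : G₁.edist (coronaProj u) (coronaProj v) ≤ 1 := by
      rcases u with u | ⟨u, a⟩ <;> rcases v with v | ⟨v, b⟩
      · have huv' : G₁.Adj u v := huv
        exact (edist_eq_one_iff_adj.mpr huv').le
      · obtain rfl : u = v := huv
        simp [coronaProj]
      · obtain rfl : u = v := huv
        simp [coronaProj]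
      · obtain rfl : u = v := huv.1
        simp [coronaProj]
    calc _ ≤ _ := SimpleGraph.edist_triangle (v := coronaProj v)
      _ ≤ 1 + (p.length : ℕ∞) := add_le_add h1 ih
      _ = _ := by simp [add_comm]

theorem edist_corona_inl_le (u w : V₁) :
    (G₁.corona G₂).edist (Sum.inl u) (Sum.inl w) ≤ G₁.edist u w := by
  let f : G₁ →g G₁.corona G₂ := ⟨Sum.inl, fun h => h⟩
  refine le_iInf fun p => (edist_le (p.map f)).trans ?_
  simp

/-- The vertex `v` of `G₁` together with its copy of `G₂`. -/
def coronaCone (V₂ : Type*) (v : V₁) : Set (V₁ ⊕ V₁ × V₂) := {u | coronaProj u = v}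

/-- Edges of `G₁` are the only ones joining different cones. Adding the apex to the complement puts
those that end at `v` on the outer side. -/
theorem isSeparatedAt_coronaCone (v : V₁) :
    (G₁.corona G₂).IsSeparatedAt (Sum.inl v) (coronaCone V₂ v)
      (insert (Sum.inl v) (coronaCone V₂ v)ᶜ) where
  eq_of_mem u hA hB := hB.resolve_right fun h => h hA
  mem_or_mem u := (em _).imp_right Or.inr
  edge := by
    rintro (u | ⟨u, a⟩) (w | ⟨w, b⟩) h
    · right
      simp only [coronaCone, coronaProj, Set.mem_insert_iff, Sum.inl.injEq, Set.mem_compl_iff,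
        Set.mem_ofPred_eq, Sum.elim_inl, id]
      exact ⟨em _, em _⟩
    · obtain rfl : u = w := h
      by_cases huv : u = v <;> simp [coronaCone, coronaProj, huv]
    · obtain rfl : u = w := h
      by_cases huv : u = v <;> simp [coronaCone, coronaProj, huv]
    · obtain rfl : u = w := h.1
      by_cases huv : u = v <;> simp [coronaCone, coronaProj, huv]

/-! ### The isometric copy of $G_1$ in the corona, and the retraction onto it -/

namespace Realization

/-- The inclusion of the realization of `G₁` into that of the corona. -/
def toCorona (G₂ : SimpleGraph V₂) (x : G₁.Realization) : (G₁.corona G₂).Realization where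
  coord := Sum.elim x.coord 0
  coord_nonneg := by
    rintro (v | v)
    · exact x.coord_nonneg v
    · exact le_rfl
  vertex_or_edge := by
    rcases x.vertex_or_edge with ⟨v, h1, h2⟩ | ⟨u, v, huv, h1, h2⟩
    · refine Or.inl ⟨Sum.inl v, h1, ?_⟩
      rintro (w | w) hw
      · exact h2 w fun e => hw (e ▸ rfl)
      · rfl
    · refine Or.inr ⟨Sum.inl u, Sum.inl v, huv, h1, ?_⟩
      rintro (w | w) hw hw'
      · exact h2 w (fun e => hw (e ▸ rfl)) fun e => hw' (e ▸ rfl)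
      · rfl

theorem toCorona_injective : Function.Injective (toCorona (G₁ := G₁) G₂) := fun x y h => by
  ext v
  exact congrFun (congrArg coord h) (Sum.inl v)

theorem toCorona_onEdge {x : G₁.Realization} {u v : V₁} :
    (x.toCorona G₂).OnEdge (Sum.inl u) (Sum.inl v) ↔ x.OnEdge u v := by
  refine and_congr Iff.rfl ⟨fun h w h1 h2 => h (Sum.inl w) (by simpa) (by simpa), ?_⟩
  rintro h (w | w) h1 h2
  · exact h w (by simpa using h1) (by simpa using h2)
  · rfl

theorem toCorona_ofVertex (v : V₁) :
    (ofVertex v : G₁.Realization).toCorona G₂ = ofVertex (Sum.inl v) := by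
  refine eq_ofVertex ?_
  rintro (w | w) hw
  · exact ofVertex_coord_of_ne (G := G₁) fun e => hw (e ▸ rfl)
  · rfl

theorem toCorona_distToVertex_le (x : G₁.Realization) (w : V₁) :
    (x.toCorona G₂).distToVertex (Sum.inl w) ≤ x.distToVertex w := by
  refine le_iInf₂ fun u hu => (iInf₂_le (Sum.inl u) hu).trans (add_le_add le_rfl ?_)
  exact_mod_cast edist_corona_inl_le (G₂ := G₂) u w

theorem le_toCorona_distToVertex (x : G₁.Realization) (w : V₁ ⊕ V₁ × V₂) :
    x.distToVertex (coronaProj w) ≤ (x.toCorona G₂).distToVertex w := by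
  refine le_iInf₂ fun u hu => ?_
  rcases u with u | u
  · refine (iInf₂_le u hu).trans (add_le_add le_rfl ?_)
    exact_mod_cast edist_coronaProj_le (G₁ := G₁) (G₂ := G₂) (Sum.inl u) w
  · exact absurd rfl hu

/-- If an end of the edge lies in a copy of `G₂`, both points have coordinate `0` there, so both
equal the other end and coincide. -/
theorem edist_le_of_toCorona_onEdge {x y : G₁.Realization} {u v : V₁ ⊕ V₁ × V₂}
    (hx : (x.toCorona G₂).OnEdge u v) (hy : (y.toCorona G₂).OnEdge u v) :
    EDist.edist x y ≤ ENNReal.ofReal |(x.toCorona G₂).coord u - (y.toCorona G₂).coord u| := by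
  have vert : ∀ (u : V₁ ⊕ V₁ × V₂) (q : V₁ × V₂), (x.toCorona G₂).OnEdge u (Sum.inr q) →
      (y.toCorona G₂).OnEdge u (Sum.inr q) → x = y := fun u q hx hy => by
    have key : ∀ z : G₁.Realization, (z.toCorona G₂).OnEdge u (Sum.inr q) →
        z.toCorona G₂ = ofVertex u := fun z hz => eq_ofVertex fun w hw => by
      by_cases hwq : w = Sum.inr q
      · rw [hwq]; rfl
      · exact hz.2 w hw hwq
    exact toCorona_injective (G₂ := G₂) ((key x hx).trans (key y hy).symm)
  rcases v with v | q
  · rcases u with u | q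
    · exact (min_le_left _ _).trans
        (distInEdge_le (toCorona_onEdge.mp hx) (toCorona_onEdge.mp hy))
    · rw [vert _ q hx.symm hy.symm]; simp
  · rw [vert _ q hx hy]; simp

theorem isometry_toCorona : Isometry (toCorona (G₁ := G₁) G₂) := fun x y => by
  refine le_antisymm (le_min ?_ (le_iInf fun w => ?_)) (le_min ?_ (le_iInf fun w => ?_))
  · refine le_iInf fun u => le_iInf fun v => le_iInf fun hx => le_iInf fun hy => ?_
    exact (min_le_left _ _).trans
      (distInEdge_le (toCorona_onEdge.mpr hx) (toCorona_onEdge.mpr hy))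
  · exact (min_le_right _ _).trans (iInf_le_of_le (Sum.inl w)
      (add_le_add (toCorona_distToVertex_le x w) (toCorona_distToVertex_le y w)))
  · exact le_iInf fun u => le_iInf fun v => le_iInf fun hx => le_iInf fun hy =>
      edist_le_of_toCorona_onEdge hx hy
  · exact (min_le_right _ _).trans (iInf_le_of_le (coronaProj w)
      (add_le_add (le_toCorona_distToVertex x w) (le_toCorona_distToVertex y w)))

/-- Every point of the corona lies in `G₁` or in the cone over a copy of `G₂`. -/
theorem exists_toCorona_or_supportedIn (x : (G₁.corona G₂).Realization) :
    ∃ y : G₁.Realization, x = y.toCorona G₂ ∨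
      ∃ v, y = ofVertex v ∧ x.SupportedIn (coronaCone V₂ v) := by
  by_cases h : ∃ v, x.SupportedIn (coronaCone V₂ v)
  · obtain ⟨v, hv⟩ := h
    exact ⟨ofVertex v, Or.inr ⟨v, rfl, hv⟩⟩
  rcases x.vertex_or_edge with ⟨u, -, h2⟩ | ⟨u, v, huv, h1, h2⟩
  · refine absurd ⟨coronaProj u, fun w hw => ?_⟩ h
    by_contra hne
    exact hw (h2 w fun e => hne (e ▸ rfl))
  · have cone : coronaProj u ≠ coronaProj v := fun e => by
      refine h ⟨coronaProj u, fun w hw => ?_⟩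
      by_contra hne
      exact hw (h2 w (fun e' => hne (e' ▸ rfl)) fun e' => hne (e' ▸ e.symm))
    rcases u with u | ⟨u, a⟩ <;> rcases v with v | ⟨v, b⟩
    · refine ⟨⟨fun w => x.coord (Sum.inl w), fun w => x.coord_nonneg _, Or.inr ⟨u, v, huv, h1,
        fun w hu hv => h2 _ (by simpa) (by simpa)⟩⟩, Or.inl ?_⟩
      ext (w | w)
      · rfl
      · exact h2 _ (by simp) (by simp)
    · exact absurd huv cone
    · exact absurd huv cone
    · exact absurd huv.1 cone

/-- The retraction of the realization of the corona onto that of `G₁`. -/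
noncomputable def ofCorona (x : (G₁.corona G₂).Realization) : G₁.Realization :=
  (exists_toCorona_or_supportedIn x).choose

theorem ofCorona_spec (x : (G₁.corona G₂).Realization) :
    x = (ofCorona x).toCorona G₂ ∨
      ∃ v, ofCorona x = ofVertex v ∧ x.SupportedIn (coronaCone V₂ v) :=
  (exists_toCorona_or_supportedIn x).choose_spec

/-- The choice made in `ofCorona` is harmless here: the only point of `G₁` in the cone over `v` is
`v` itself. -/
theorem ofCorona_toCorona (x : G₁.Realization) : ofCorona (x.toCorona G₂) = x := by
  rcases ofCorona_spec (x.toCorona G₂) with h | ⟨v, h, hv⟩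
  · exact (toCorona_injective h).symm
  · rw [h]
    refine (eq_ofVertex fun w hw => ?_).symm
    by_contra hne
    exact hw (hv (Sum.inl w) hne)

/-- Source of the constant: at most `1/2` to the nearer end of the edge, then at most one edge to
the apex. -/
theorem distToVertex_le_of_supportedIn {x : (G₁.corona G₂).Realization} {v : V₁}
    (hx : x.SupportedIn (coronaCone V₂ v)) :
    x.distToVertex (Sum.inl v) ≤ (3 / 2 : ℝ≥0) := by
  obtain ⟨u, hu⟩ := x.exists_half_le_coord
  have hu0 : x.coord u ≠ 0 := by intro h; rw [h] at hu; norm_num at hu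
  have hd : (G₁.corona G₂).edist u (Sum.inl v) ≤ 1 := by
    have huv : coronaProj u = v := hx u hu0
    rcases u with u | ⟨u, a⟩
    · obtain rfl : u = v := huv
      simp
    · exact (edist_eq_one_iff_adj.mpr huv).le
  have hd' : ((G₁.corona G₂).edist u (Sum.inl v) : ℝ≥0∞) ≤ 1 := by exact_mod_cast hd
  calc x.distToVertex (Sum.inl v) ≤ _ := iInf₂_le u hu0
    _ ≤ ENNReal.ofReal (1 / 2) + ENNReal.ofReal 1 :=
        add_le_add (ENNReal.ofReal_le_ofReal (by linarith)) (by simpa using hd')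
    _ = ENNReal.ofReal ((3 / 2 : ℝ≥0) : ℝ) := by
        rw [← ENNReal.ofReal_add (by norm_num) (by norm_num)]
        congr 1
        push_cast
        norm_num
    _ = _ := ENNReal.ofReal_coe_nnreal

theorem isCutRetraction_ofCorona :
    IsCutRetraction (toCorona (G₁ := G₁) G₂) ofCorona (3 / 2) where
  isometry := isometry_toCorona
  leftInverse := ofCorona_toCorona
  edist_le x := by
    rcases ofCorona_spec x with h | ⟨v, h, hv⟩
    · rw [← h]; simp
    · rw [h, toCorona_ofVertex, edist_ofVertex]
      exact distToVertex_le_of_supportedIn hv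
  edist_eq_add x y hxy := by
    rcases ofCorona_spec x with h | ⟨v, h, hv⟩
    · rw [← h]; simp
    · rw [h, toCorona_ofVertex, PseudoEMetricSpace.edist_comm (ofVertex _) y, edist_ofVertex, edist_ofVertex]
      -- It remains to see that `y` is supported outside the cone over `v`, apart from the apex. If
      -- `y` belongs to another cone, a shared vertex would give both points the same projection.
      refine edist_eq_of_isSeparatedAt (isSeparatedAt_coronaCone v) hv fun w hw => ?_
      rcases ofCorona_spec y with h' | ⟨v', h', hv'⟩
      · rw [h'] at hw
        rcases w with w | w
        · by_cases hwv : w = v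
          · exact Or.inl (hwv ▸ rfl)
          · exact Or.inr hwv
        · exact absurd rfl hw
      · refine Or.inr fun hwv => hxy ?_
        have e : coronaProj w = v' := hv' w hw
        have e' : coronaProj w = v := hwv
        rw [h, h', ← e, ← e']

end Realization

end Corona

end SimpleGraph

theorem mainTheorem4 {V₁ V₂ : Type*} [Nonempty V₁] [Nonempty V₂]
    (G₁ : SimpleGraph V₁) (G₂ : SimpleGraph V₂) :
    (IsHyperbolic (G₁.corona G₂).Realization ↔ IsHyperbolic G₁.Realization) ∧
    hyperbolicityConst G₁.Realization ≤ hyperbolicityConst (G₁.corona G₂).Realization ∧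
    hyperbolicityConst (G₁.corona G₂).Realization ≤
      max (hyperbolicityConst G₁.Realization) (3 / 2) := by
  have hr := SimpleGraph.Realization.isCutRetraction_ofCorona (G₁ := G₁) (G₂ := G₂)
  refine ⟨hr.isHyperbolic_iff, hyperbolicityConst_le_of_isometry hr.isometry, ?_⟩
  simpa using hr.hyperbolicityConst_le
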